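/- Throughout, $(z)_n=z(z+1)\cdots(z+n-1)$ (with $(z)_0=1$), $${}_pF_q\left(\begin{array}{c}a_1,\dots,a_p\\ b_1,\dots,b_q\end{array};z\right)=\sum_{n=0}^\infty\frac{(a_1)_n\cdots(a_p)_n}{(b_1)_n\cdots(b_q)_n}\frac{z^n}{n!},$$ $$J_\nu(z)=\frac{(z/2)^\nu}{\Gamma(\nu+1)}\,{}_0F_1\left(\begin{array}{c}-\\ \nu+1\end{array};-\frac{z^2}{4}\right),\qquad I_\nu(z)=\frac{(z/2)^\nu}{\Gamma(\nu+1)}\,{}_0F_1\left(\begin{array}{c}-\\ \nu+1\end{array};\frac{z^2}{4}\right),$$ $$P_n^{(a,b)}(z)=\frac{(a+1)_n}{n!}\,{}_2F_1\left(\begin{array}{c}-n,\,n+a+b+1\\ a+1\end{array};\frac{1-z}{2}\right),$$ and all powers and square roots are principal. **Theorem.** Let $\alpha\in\mathbf C$ and $\beta,\gamma>-1$ be such that if $\beta,\gamma\in(-1,0)$ then $\beta+\gamma+1\neq0$, and suppose that neither $\alpha+1$ nor $\alpha+\beta+1$ is a non-positive integer. Let $\rho\in\mathbf C$ with $|\rho|<1$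 and let $x\in(-1,1)$. Then $$\left(\frac{2}{(1-x)\rho}\right)^{\alpha/2}\left(\frac{2}{(1+x)\rho}\right)^{\beta/2}J_\alpha\left(\sqrt{2(1-x)\rho}\right)I_\beta\left(\sqrt{2(1+x)\rho}\right)$$ $$=\frac{1}{(\gamma+\beta+1)\Gamma(\alpha+1)\Gamma(\beta+1)}\sum_{k=0}^\infty\frac{(2k+\gamma+\beta+1)(\gamma+\beta+1)_k\left(\frac{\alpha+\beta+1}{2}\right)_k\left(\frac{\alpha+\beta+2}{2}\right)_k}{(\alpha+1)_k(\beta+1)_k(\alpha+\beta+1)_k\left(\frac{\gamma+\beta+2}{2}\right)_k\left(\frac{\gamma+\beta+3}{2}\right)_k}$$ $$\qquad\times{}_2F_3\left(\begin{array}{c}2k+\alpha+\beta+1,\ \alpha-\gamma\\ \alpha+\beta+k+1,\ \gamma+\beta+2k+2,\ \alpha+k+1\end{array};\rho\right)\rho^k\,P_k^{(\gamma,\beta)}(x),$$ where the series converges absolutely for every $\rho$ with $|\rho|<1$. For $\rho\notin(-1,0]$ the left-hand side is the displayed expression itself; for $\rho\in(-1,0]$ it is understood as the limit of that expression along $\rho'\to\rho$,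 $\rho'\in\mathbf C\setminus(-\infty,0]$, which exists. -/

import Mathlib

open Filter Topology

noncomputable section

/-- The Pochhammer symbol `(z)_n = z (z + 1) ⋯ (z + n - 1)`. -/
def poch (z : ℂ) (n : ℕ) : ℂ := (ascPochhammer ℂ n).eval z

/-- The generalized hypergeometric function `pFq(a₁,…,a_p; b₁,…,b_q; z)`, as the sum of its
power series; it is meaningful when no `b_j` is a non-positive integer. -/
def pFq (a b : List ℂ) (z : ℂ) : ℂ :=
  ∑' n : ℕ, (a.map fun c => poch c n).prod / (b.map fun c => poch c n).prod
    * (z ^ n / (n.factorial : ℂ))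

/-- The Bessel function of the first kind `J_ν(z)` (principal branch), for `ν` not a negative
integer and `z ≠ 0`. -/
def besselJ (ν z : ℂ) : ℂ :=
  (z / 2) ^ ν / Complex.Gamma (ν + 1) * pFq [] [ν + 1] (-z ^ 2 / 4)

/-- The modified Bessel function of the first kind `I_ν(z)` (principal branch), for `ν` not a
negative integer and `z` off `(-∞, 0]`. -/
def besselI (ν z : ℂ) : ℂ :=
  (z / 2) ^ ν / Complex.Gamma (ν + 1) * pFq [] [ν + 1] (z ^ 2 / 4)

/-- The Jacobi polynomial `P_n^{(α,β)}(z)`, for `α` not a negative integer. -/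
def jacobiP (n : ℕ) (α β z : ℂ) : ℂ :=
  poch (α + 1) n / (n.factorial : ℂ)
    * ordinaryHypergeometric (-(n : ℂ)) ((n : ℂ) + α + β + 1) (α + 1) ((1 - z) / 2)

/-- The product of Bessel functions with its power prefactors; all powers and square roots are
principal, and the expression is used for `ρ` off `(-∞, 0]` and `-1 < x < 1`. -/
def besselProduct (α β x ρ : ℂ) : ℂ :=
  (2 / ((1 - x) * ρ)) ^ (α / 2) * (2 / ((1 + x) * ρ)) ^ (β / 2)
    * besselJ α ((2 * (1 - x) * ρ) ^ (1 / 2 : ℂ))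
    * besselI β ((2 * (1 + x) * ρ) ^ (1 / 2 : ℂ))

/-- The `k`-th term of the expansion in the Jacobi polynomials `P_k^{(γ,β)}(x)`. -/
def expansionTerm (α β γ x ρ : ℂ) (k : ℕ) : ℂ :=
  (2 * (k : ℂ) + γ + β + 1) * poch (γ + β + 1) k
      * poch ((α + β + 1) / 2) k * poch ((α + β + 2) / 2) k
    / (poch (α + 1) k * poch (β + 1) k * poch (α + β + 1) k
      * poch ((γ + β + 2) / 2) k * poch ((γ + β + 3) / 2) k)
    * pFq [2 * (k : ℂ) + α + β + 1, α - γ]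
        [α + β + (k : ℂ) + 1, γ + β + 2 * (k : ℂ) + 2, α + (k : ℂ) + 1] ρ
    * ρ ^ k * jacobiP k γ β x

end

theorem poch_zero (z : ℂ) : poch z 0 = 1 := by simp [poch]

theorem poch_succ (z : ℂ) (n : ℕ) : poch z (n + 1) = poch z n * (z + n) := by
  simp [poch, ascPochhammer_succ_eval]

theorem poch_add (z : ℂ) (m n : ℕ) : poch z (m + n) = poch z m * poch (z + m) n := by
  induction n with
  | zero => simp [poch_zero]
  | succ n ih =>
    rw [← add_assoc, poch_succ, poch_succ, ih]
    push_cast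
    ring

theorem poch_succ_left (z : ℂ) (n : ℕ) : poch z (n + 1) = z * poch (z + 1) n := by
  rw [add_comm, poch_add]
  simp [poch_succ, poch_zero]

theorem poch_ne_zero {z : ℂ} (hz : ∀ n : ℕ, z ≠ -(n : ℂ)) (n : ℕ) : poch z n ≠ 0 := by
  induction n with
  | zero => simp [poch_zero]
  | succ n ih =>
    rw [poch_succ]
    exact mul_ne_zero ih fun h => hz n (eq_neg_of_add_eq_zero_left h)

theorem add_natCast_ne_neg {z : ℂ} (hz : ∀ n : ℕ, z ≠ -(n : ℂ)) (m : ℕ) :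
    ∀ n : ℕ, z + m ≠ -(n : ℂ) := by
  intro n h
  apply hz (m + n)
  push_cast
  linear_combination h

theorem ofReal_ne_neg_natCast {t : ℝ} (ht : 0 < t) (n : ℕ) : (t : ℂ) ≠ -(n : ℂ) := by
  intro h
  have h' : t = -(n : ℝ) := by exact_mod_cast h
  have : (0 : ℝ) ≤ n := n.cast_nonneg
  linarith

theorem poch_two_mul (z : ℂ) (k : ℕ) :
    poch z (2 * k) = 4 ^ k * poch (z / 2) k * poch ((z + 1) / 2) k := by
  induction k with
  | zero => simp [poch_zero]
  | succ k ih =>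
    rw [show 2 * (k + 1) = 2 * k + 1 + 1 by ring, poch_succ, poch_succ, ih, poch_succ, poch_succ]
    push_cast
    ring

theorem poch_one_sub_sub (z : ℂ) (m : ℕ) : poch (1 - z - m) m = (-1) ^ m * poch z m := by
  induction m with
  | zero => simp [poch_zero]
  | succ m ih =>
    rw [poch_succ_left, poch_succ,
      show (1 : ℂ) - z - (m + 1 : ℕ) + 1 = 1 - z - m by push_cast; ring, ih]
    push_cast
    ring

theorem poch_neg_natCast_add (i j : ℕ) :
    poch (-((i + j : ℕ) : ℂ)) i * j.factorial = (-1) ^ i * (i + j).factorial := by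
  induction i generalizing j with
  | zero => simp [poch_zero]
  | succ i ih =>
    have h := ih (j + 1)
    rw [Nat.factorial_succ, show i + (j + 1) = i + 1 + j by ring] at h
    rw [poch_succ]
    push_cast at h ⊢
    linear_combination -h

theorem poch_neg_natCast_of_lt {k n : ℕ} (h : k < n) : poch (-(k : ℂ)) n = 0 := by
  obtain ⟨m, rfl⟩ := Nat.exists_eq_add_of_lt h
  rw [add_assoc, add_comm m 1, ← add_assoc, poch_add, poch_succ]
  simp

/-- The Chu–Vandermonde identity for Pochhammer symbols read downwards. -/
theorem poch_vandermonde (x y : ℂ) (k : ℕ) :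
    poch (x + y - k + 1) k = ∑ ij ∈ Finset.HasAntidiagonal.antidiagonal k,
      (k.choose ij.1 : ℂ) * (poch (x - ij.1 + 1) ij.1 * poch (y - ij.2 + 1) ij.2) := by
  have h := Ring.descPochhammer_smeval_add k (Commute.all x y)
  simpa only [poch, Polynomial.descPochhammer_smeval_eq_ascPochhammer,
    Polynomial.ascPochhammer_smeval_eq_eval] using h

theorem sum_antidiagonal_assoc {M : Type*} [AddCommMonoid M] (f : ℕ → ℕ → ℕ → M) (N : ℕ) :
    ∑ a ∈ Finset.HasAntidiagonal.antidiagonal N, ∑ b ∈ Finset.HasAntidiagonal.antidiagonal a.1, f b.1 b.2 a.2 =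
      ∑ a ∈ Finset.HasAntidiagonal.antidiagonal N, ∑ b ∈ Finset.HasAntidiagonal.antidiagonal a.2, f a.1 b.1 b.2 := by
  rw [Finset.sum_sigma', Finset.sum_sigma']
  refine Finset.sum_nbij' (fun t => ⟨(t.2.1, t.2.2 + t.1.2), (t.2.2, t.1.2)⟩)
    (fun t => ⟨(t.1.1 + t.2.1, t.2.2), (t.1.1, t.2.1)⟩) ?_ ?_ ?_ ?_ ?_
  · rintro ⟨⟨a, b⟩, ⟨c, d⟩⟩
    simp only [Finset.mem_sigma, Finset.HasAntidiagonal.mem_antidiagonal]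
    rintro ⟨rfl, rfl⟩
    simp [add_comm, add_left_comm]
  · rintro ⟨⟨a, b⟩, ⟨c, d⟩⟩
    simp only [Finset.mem_sigma, Finset.HasAntidiagonal.mem_antidiagonal]
    rintro ⟨rfl, rfl⟩
    simp [add_comm, add_left_comm]
  · rintro ⟨⟨a, b⟩, ⟨c, d⟩⟩
    simp only [Finset.mem_sigma, Finset.HasAntidiagonal.mem_antidiagonal]
    rintro ⟨rfl, rfl⟩
    rfl
  · rintro ⟨⟨a, b⟩, ⟨c, d⟩⟩
    simp only [Finset.mem_sigma, Finset.HasAntidiagonal.mem_antidiagonal]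
    rintro ⟨rfl, rfl⟩
    rfl
  · rintro ⟨⟨a, b⟩, ⟨c, d⟩⟩
    simp

/-- The homogeneous part of degree `N` of the product of `₀F₁(; p; -u)` and `₀F₁(; q; v)`. -/
noncomputable def prodCoeff (p q u v : ℂ) (N : ℕ) : ℂ :=
  ∑ a ∈ Finset.HasAntidiagonal.antidiagonal N,
    (-u) ^ a.1 / (poch p a.1 * a.1.factorial) * (v ^ a.2 / (poch q a.2 * a.2.factorial))

theorem prodCoeff_swap (p q u v : ℂ) (N : ℕ) :
    prodCoeff q p v u N = (-1) ^ N * prodCoeff p q u v N := by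
  unfold prodCoeff
  rw [← Finset.Nat.sum_antidiagonal_swap, Finset.mul_sum]
  refine Finset.sum_congr rfl fun a ha => ?_
  rw [← Finset.HasAntidiagonal.mem_antidiagonal.1 ha]
  simp only [Prod.fst_swap, Prod.snd_swap]
  rw [neg_pow v, neg_pow u, pow_add]
  linear_combination (- (-1) ^ a.2 * v ^ a.2 / (poch q a.2 * a.2.factorial) *
    (u ^ a.1 / (poch p a.1 * a.1.factorial))) * (by rw [← mul_pow]; simp : (-1 : ℂ) ^ a.1 * (-1) ^ a.1 = 1)

theorem prodCoeff_one_sub {p q : ℂ} (hp : ∀ n : ℕ, p ≠ -(n : ℂ)) (hq : ∀ n : ℕ, q ≠ -(n : ℂ))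
    (v : ℂ) (N : ℕ) :
    poch p N * prodCoeff p q (1 - v) v N = ∑ a ∈ Finset.HasAntidiagonal.antidiagonal N,
      (-1) ^ a.2 * poch (N + p + q - 1) a.1 / (a.2.factorial * a.1.factorial * poch q a.1)
        * v ^ a.1 := by
  have hpow (m : ℕ) : (-(1 - v)) ^ m = ∑ b ∈ Finset.HasAntidiagonal.antidiagonal m,
      (m.factorial : ℂ) * ((-1) ^ b.1 / b.1.factorial * (v ^ b.2 / b.2.factorial)) := by
    rw [show -(1 - v) = -1 + v by ring, (Commute.all (-1 : ℂ) v).add_pow']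
    refine Finset.sum_congr rfl fun b hb => ?_
    obtain rfl := Finset.HasAntidiagonal.mem_antidiagonal.1 hb
    rw [nsmul_eq_mul, Nat.cast_add_choose]
    ring
  have h1 : prodCoeff p q (1 - v) v N = ∑ a ∈ Finset.HasAntidiagonal.antidiagonal N,
      ∑ b ∈ Finset.HasAntidiagonal.antidiagonal a.1, (-1) ^ b.1 / b.1.factorial * (v ^ b.2 / b.2.factorial)
        / poch p (N - a.2) * (v ^ a.2 / (poch q a.2 * a.2.factorial)) := by
    refine Finset.sum_congr rfl fun a ha => ?_
    have ha' : N - a.2 = a.1 := by have := Finset.HasAntidiagonal.mem_antidiagonal.1 ha; omega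
    rw [hpow, ha', Finset.sum_div, Finset.sum_mul]
    refine Finset.sum_congr rfl fun b _ => ?_
    have := Nat.cast_ne_zero (R := ℂ).2 a.1.factorial_ne_zero
    have := poch_ne_zero hp a.1
    field_simp
  rw [h1, sum_antidiagonal_assoc (fun r l n => (-1) ^ r / (r.factorial : ℂ) *
    (v ^ l / l.factorial) / poch p (N - n) * (v ^ n / (poch q n * n.factorial))),
    ← Finset.Nat.sum_antidiagonal_swap, Finset.mul_sum]
  refine Finset.sum_congr rfl fun a ha => ?_
  obtain ⟨i, r⟩ := a
  have hN : i + r = N := Finset.HasAntidiagonal.mem_antidiagonal.1 ha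
  simp only [Prod.fst_swap, Prod.snd_swap]
  have hv := poch_vandermonde (N + p - 1) (i + q - 1) i
  rw [show (N + p - 1 + (i + q - 1) - i + 1 : ℂ) = N + p + q - 1 by ring] at hv
  rw [hv, ← Finset.Nat.sum_antidiagonal_swap, Finset.mul_sum, Finset.mul_sum, Finset.sum_div,
    Finset.sum_mul]
  refine Finset.sum_congr rfl fun b hb => ?_
  obtain ⟨n, l⟩ := b
  obtain rfl : n + l = i := Finset.HasAntidiagonal.mem_antidiagonal.1 hb
  simp only [Prod.fst_swap, Prod.snd_swap]
  have e1 : poch p N = poch p (N - n) * poch (N + p - 1 - n + 1) n := by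
    conv_lhs => rw [show N = (N - n) + n by omega, poch_add]
    rw [Nat.cast_sub (by omega)]
    congr 2
    ring
  have e2 : poch q (n + l) = poch q n * poch ((n + l : ℕ) + q - 1 - l + 1) l := by
    rw [poch_add]
    congr 2
    push_cast
    ring
  have n0 := poch_ne_zero hq (n + l)
  rw [e2] at n0 ⊢
  rw [e1, Nat.cast_add_choose, pow_add]
  have n1 := left_ne_zero_of_mul n0
  have n2 := right_ne_zero_of_mul n0
  have n3 := poch_ne_zero hp (N - n)
  have f1 := Nat.cast_ne_zero (R := ℂ).2 n.factorial_ne_zero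
  have f2 := Nat.cast_ne_zero (R := ℂ).2 l.factorial_ne_zero
  have f3 := Nat.cast_ne_zero (R := ℂ).2 r.factorial_ne_zero
  have f4 := Nat.cast_ne_zero (R := ℂ).2 (n + l).factorial_ne_zero
  field_simp

theorem jacobiP_eq_prodCoeff {r q : ℂ} (hr : ∀ n : ℕ, r ≠ -(n : ℂ))
    (hq : ∀ n : ℕ, q ≠ -(n : ℂ)) (x : ℂ) (k : ℕ) :
    jacobiP k (r - 1) (q - 1) x =
      poch r k * poch q k * prodCoeff r q ((1 - x) / 2) ((1 + x) / 2) k := by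
  have hs := prodCoeff_swap q r ((1 + x) / 2) ((1 - x) / 2) k
  have h1 := prodCoeff_one_sub hq hr ((1 - x) / 2) k
  rw [show (1 : ℂ) - (1 - x) / 2 = (1 + x) / 2 by ring] at h1
  rw [hs, jacobiP, ordinaryHypergeometric_eq_tsum, sub_add_cancel]
  rw [show poch r k * poch q k * ((-1) ^ k * prodCoeff q r ((1 + x) / 2) ((1 - x) / 2) k) =
    (-1) ^ k * poch r k * (poch q k * prodCoeff q r ((1 + x) / 2) ((1 - x) / 2) k) by ring, h1]
  simp only [← poch.eq_1, smul_eq_mul]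
  rw [tsum_eq_sum (s := Finset.range (k + 1)) (fun n hn => by
    rw [poch_neg_natCast_of_lt (by simpa using hn)]; simp),
    Finset.Nat.sum_antidiagonal_eq_sum_range_succ_mk, Finset.mul_sum, Finset.mul_sum]
  refine Finset.sum_congr rfl fun i hi => ?_
  obtain ⟨j, rfl⟩ := Nat.exists_eq_add_of_le (Nat.lt_succ_iff.1 (Finset.mem_range.1 hi))
  rw [Nat.add_sub_cancel_left]
  have h2 := poch_neg_natCast_add i j
  have n1 := poch_ne_zero hr i
  have f1 := Nat.cast_ne_zero (R := ℂ).2 i.factorial_ne_zero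
  have f2 := Nat.cast_ne_zero (R := ℂ).2 j.factorial_ne_zero
  have f3 := Nat.cast_ne_zero (R := ℂ).2 (i + j).factorial_ne_zero
  rw [show (((i + j : ℕ) : ℂ) + (r - 1) + (q - 1) + 1) = (i + j : ℕ) + q + r - 1 by ring,
    show poch (-((i + j : ℕ) : ℂ)) i = (-1) ^ i * (i + j).factorial / j.factorial by
      rw [eq_div_iff f2, h2]]
  have hsg : (-1 : ℂ) ^ (i + j) * (-1) ^ j = (-1) ^ i := by
    rw [pow_add, mul_assoc, ← mul_pow]; simp
  rw [← hsg]
  field_simp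

theorem wellPoised_partial_sum {S : ℂ} (hS : ∀ n : ℕ, S ≠ -(n : ℂ)) (b : ℂ) (M n : ℕ)
    (hn : n ≤ M) :
    ∑ j ∈ Finset.range (n + 1), ((M + 1).choose j : ℂ) * poch b j *
        poch (S + 1 - b + j) (M + 1 - j) * (S + 2 * j) / poch (S + j) (M + 1 + 1) =
      ∑ j ∈ Finset.range (n + 1), (M.choose j : ℂ) * poch b j *
        poch (S + 1 - b + j) (M - j) * (S + 2 * j) / poch (S + j) (M + 1)
      - (M.choose n : ℂ) * poch b (n + 1) * poch (S + 1 - b + n) (M - n)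
        / poch (S + n + 1) (M + 1) := by
  induction n with
  | zero =>
    have h0 : S ≠ 0 := by simpa using hS 0
    have h1 : poch (S + 1) M ≠ 0 :=
      poch_ne_zero (by exact_mod_cast add_natCast_ne_neg hS 1) M
    have h2 : S + 1 + M ≠ 0 := by
      have := add_natCast_ne_neg hS (1 + M) 0
      push_cast at this
      simpa [add_assoc] using this
    simp only [zero_add, Finset.sum_range_one, Nat.choose_zero_right, Nat.cast_one, Nat.cast_zero,
      poch_zero, Nat.sub_zero, mul_zero, add_zero]
    rw [poch_succ_left S (M + 1), poch_succ_left S M, poch_succ (S + 1) M, poch_succ _ M,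
      poch_succ b 0, poch_zero]
    push_cast
    field_simp
    ring
  | succ j ih =>
    rw [Finset.sum_range_succ, ih (by omega),
      Finset.sum_range_succ (fun j => (M.choose j : ℂ) * poch b j *
        poch (S + 1 - b + j) (M - j) * (S + 2 * j) / poch (S + j) (M + 1)) (j + 1)]
    generalize ∑ j ∈ Finset.range (j + 1), (M.choose j : ℂ) * poch b j *
      poch (S + 1 - b + j) (M - j) * (S + 2 * j) / poch (S + j) (M + 1) = T
    obtain ⟨d, rfl⟩ := Nat.exists_eq_add_of_le hn
    have hc : ((j + 1 + d).choose (j + 1) : ℂ) * (j + 1) = (j + 1 + d).choose j * (d + 1) := by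
      have := Nat.choose_succ_right_eq (j + 1 + d) j
      rw [show j + 1 + d - j = d + 1 by omega] at this
      exact_mod_cast this
    have hd : (d : ℂ) + 1 ≠ 0 := by exact_mod_cast d.succ_ne_zero
    have hX : ((j + 1 + d).choose j : ℂ) = (j + 1 + d).choose (j + 1) * (j + 1) / (d + 1) := by
      rw [eq_div_iff hd, hc]
    rw [show j + 1 + d + 1 - (j + 1) = d + 1 by omega, show j + 1 + d - j = d + 1 by omega,
      show j + 1 + d - (j + 1) = d by omega, Nat.choose_succ_succ, Nat.succ_eq_add_one,
      poch_succ_left (S + 1 - b + j) d, poch_succ _ d, poch_succ b (j + 1),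
      poch_succ_left (S + (j + 1 : ℕ)) (j + 1 + d + 1), poch_succ_left (S + (j + 1 : ℕ)) (j + 1 + d),
      poch_succ (S + (j + 1 : ℕ) + 1) (j + 1 + d),
      show S + (j : ℂ) + 1 = S + (j + 1 : ℕ) by push_cast; ring,
      poch_succ_left (S + (j + 1 : ℕ)) (j + 1 + d),
      show S + 1 - b + (j : ℂ) + 1 = S + 1 - b + (j + 1 : ℕ) by push_cast; ring]
    have h0 : S + (j + 1 : ℕ) ≠ 0 := by
      simpa using add_natCast_ne_neg hS (j + 1) 0
    have h1 : poch (S + (j + 1 : ℕ) + 1) (j + 1 + d) ≠ 0 :=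
      poch_ne_zero (by exact_mod_cast add_natCast_ne_neg (add_natCast_ne_neg hS (j + 1)) 1) _
    have h2 : S + (j + 1 : ℕ) + 1 + (j + 1 + d : ℕ) ≠ 0 := by
      have := add_natCast_ne_neg hS (j + 1 + 1 + (j + 1 + d)) 0
      push_cast at this ⊢
      simpa [add_assoc] using this
    generalize poch (S + (j + 1 : ℕ) + 1) (j + 1 + d) = P at h1 ⊢
    generalize poch (S + 1 - b + (j + 1 : ℕ)) d = C
    push_cast at h0 h2 ⊢
    rw [hX]
    field_simp
    ring

/-- The sum of a terminating well-poised series `₄F₃(-1)`, cleared of its denominators. -/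
theorem wellPoised_sum {S : ℂ} (hS : ∀ n : ℕ, S ≠ -(n : ℂ)) (b : ℂ) (M : ℕ) :
    ∑ j ∈ Finset.range (M + 1), (M.choose j : ℂ) * poch b j * poch (S + 1 - b + j) (M - j)
      * (S + 2 * j) / poch (S + j) (M + 1) = 1 := by
  induction M with
  | zero =>
    have : S ≠ 0 := by simpa using hS 0
    simp [poch_zero, poch_succ, this]
  | succ M ih =>
    have h1 : poch (S + M + 1) (M + 1) ≠ 0 :=
      poch_ne_zero (by exact_mod_cast add_natCast_ne_neg (add_natCast_ne_neg hS M) 1) _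
    have h2 : S + M + 1 + (M + 1) ≠ 0 := by
      have := add_natCast_ne_neg hS (M + 1 + (M + 1)) 0
      push_cast at this
      simpa [add_assoc] using this
    rw [Finset.sum_range_succ, wellPoised_partial_sum hS b M M le_rfl, ih]
    simp only [Nat.choose_self, Nat.sub_self, poch_zero, Nat.cast_one]
    rw [show S + ((M + 1 : ℕ) : ℂ) = S + M + 1 by push_cast; ring, poch_succ _ (M + 1)]
    push_cast
    field_simp
    ring

/-- The connection formula between the families with lower parameters `(p, q)` and `(r, q)`,
equivalent to the one between the Jacobi polynomials `P_N^{(p-1,q-1)}` and `P_k^{(r-1,q-1)}`. -/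
theorem prodCoeff_connection {p q r : ℂ} (hp : ∀ n : ℕ, p ≠ -(n : ℂ)) (hq : ∀ n : ℕ, q ≠ -(n : ℂ))
    (hr : ∀ n : ℕ, r ≠ -(n : ℂ)) (hs : ∀ n : ℕ, r + q - 1 ≠ -(n : ℂ)) (v : ℂ) (N : ℕ) :
    poch p N * prodCoeff p q (1 - v) v N = ∑ a ∈ Finset.HasAntidiagonal.antidiagonal N,
      poch (N + p + q - 1) a.1 * poch (p - r) a.2 / (poch (a.1 + r + q - 1) a.1 *
        poch (2 * a.1 + r + q) a.2 * a.2.factorial) * (poch r a.1 * prodCoeff r q (1 - v) v a.1) := by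
  set s := r + q - 1 with hs'
  have step (k m : ℕ) (hk : k + m = N) :
      poch (N + p + q - 1) k * poch (p - r) m / (poch (k + r + q - 1) k *
        poch (2 * k + r + q) m * m.factorial) * (poch r k * prodCoeff r q (1 - v) v k) =
      ∑ a ∈ Finset.HasAntidiagonal.antidiagonal k,
        poch (N + p + q - 1) (a.1 + a.2) * poch (p - r) m / (poch (a.1 + a.2 + r + q - 1) (a.1 + a.2) *
        poch (2 * (a.1 + a.2) + r + q) m * m.factorial) *
        ((-1) ^ a.2 * poch (a.1 + a.2 + r + q - 1) a.1 / (a.2.factorial * a.1.factorial * poch q a.1)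
        * v ^ a.1) := by
    rw [prodCoeff_one_sub hr hq, Finset.mul_sum]
    refine Finset.sum_congr rfl fun a ha => ?_
    rw [← Finset.HasAntidiagonal.mem_antidiagonal.1 ha]
    push_cast
    rfl
  rw [Finset.sum_congr rfl fun a ha => step a.1 a.2 (Finset.HasAntidiagonal.mem_antidiagonal.1 ha),
    sum_antidiagonal_assoc (fun i j m =>
        poch (N + p + q - 1) (i + j) * poch (p - r) m / (poch (i + j + r + q - 1) (i + j) *
        poch (2 * (i + j) + r + q) m * m.factorial) *
        ((-1) ^ j * poch (i + j + r + q - 1) i / (j.factorial * i.factorial * poch q i)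
        * v ^ i)), prodCoeff_one_sub hp hq]
  refine Finset.sum_congr rfl fun a ha => ?_
  obtain ⟨i, M⟩ := a
  have hN : i + M = N := Finset.HasAntidiagonal.mem_antidiagonal.1 ha
  dsimp only
  have hS : ∀ n : ℕ, s + 2 * i ≠ -(n : ℂ) := by
    exact_mod_cast add_natCast_ne_neg hs (2 * i)
  have hw := wellPoised_sum hS (N + p + q - 1 + i) M
  refine (mul_one _).symm.trans ((congrArg _ hw.symm).trans ?_)
  rw [← Finset.Nat.sum_antidiagonal_eq_sum_range_succ
    (fun j m => (M.choose j : ℂ) * poch (N + p + q - 1 + i) j *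
      poch (s + 2 * i + 1 - (N + p + q - 1 + i) + j) m
      * (s + 2 * i + 2 * j) / poch (s + 2 * i + j) (M + 1)), Finset.mul_sum]
  refine Finset.sum_congr rfl fun b hb => ?_
  obtain ⟨j, m⟩ := b
  have hM : j + m = M := Finset.HasAntidiagonal.mem_antidiagonal.1 hb
  dsimp only
  have hm : poch (s + 2 * i + 1 - (N + p + q - 1 + i) + j) m = (-1) ^ m * poch (p - r) m := by
    rw [← poch_one_sub_sub, ← hN, ← hM, hs']
    congr 1
    push_cast
    ring
  have hd : poch (i + j + r + q - 1) (i + j) * (s + 2 * i + 2 * j) * poch (2 * (i + j) + r + q) m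
      = poch (i + j + r + q - 1) i * poch (s + 2 * i + j) (M + 1) := by
    have h1 := poch_add (i + j + r + q - 1) (i + j) (1 + m)
    have h2 := poch_add (i + j + r + q - 1) i (j + (1 + m))
    rw [add_comm 1 m, poch_succ_left] at h1
    rw [← add_assoc, add_comm 1 m, h1, show j + (m + 1) = M + 1 by omega] at h2
    rw [hs', show r + q - 1 + 2 * (i : ℂ) + 2 * j = i + j + r + q - 1 + (i + j : ℕ) by
      push_cast; ring, show r + q - 1 + 2 * (i : ℂ) + j = i + j + r + q - 1 + i by ring,
      ← h2, show 2 * ((i : ℂ) + j) + r + q = i + j + r + q - 1 + (i + j : ℕ) + 1 by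
      push_cast; ring, mul_assoc]
  have hA : poch (N + p + q - 1) (i + j) = poch (N + p + q - 1) i * poch (N + p + q - 1 + i) j :=
    poch_add _ _ _
  have n1 : poch (i + j + r + q - 1) i ≠ 0 := by
    have := poch_ne_zero (add_natCast_ne_neg hs (i + j)) i
    convert this using 2
    push_cast
    ring
  have n2 : poch (s + 2 * i + j) (M + 1) ≠ 0 :=
    poch_ne_zero (add_natCast_ne_neg hS j) _
  have n3 := mul_ne_zero n1 n2
  rw [← hd] at n3
  have n4 := right_ne_zero_of_mul n3
  have n5 := right_ne_zero_of_mul (left_ne_zero_of_mul n3)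
  have n6 := left_ne_zero_of_mul (left_ne_zero_of_mul n3)
  have n7 := poch_ne_zero hq i
  have f1 := Nat.cast_ne_zero (R := ℂ).2 i.factorial_ne_zero
  have f2 := Nat.cast_ne_zero (R := ℂ).2 j.factorial_ne_zero
  have f3 := Nat.cast_ne_zero (R := ℂ).2 m.factorial_ne_zero
  have f4 := Nat.cast_ne_zero (R := ℂ).2 M.factorial_ne_zero
  have hsg : (-1 : ℂ) ^ M * (-1) ^ m = (-1) ^ j := by
    rw [← hM, pow_add, mul_assoc, ← mul_pow]; simp
  have hch : (M.choose j : ℂ) = M.factorial / (j.factorial * m.factorial) := by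
    rw [← hM, Nat.cast_add_choose]
  have hden : poch (s + 2 * i + j) (M + 1) = poch (i + j + r + q - 1) (i + j) *
      (s + 2 * i + 2 * j) * poch (2 * (i + j) + r + q) m / poch (i + j + r + q - 1) i := by
    rw [eq_div_iff n1, hd, mul_comm]
  rw [hm, hA, hch, hden, ← hsg]
  generalize s + 2 * (i : ℂ) + 2 * j = w at n5 ⊢
  field_simp

theorem norm_poch_add_le (z : ℂ) : ∃ K : ℝ, 0 ≤ K ∧ ∀ m n : ℕ,
    ‖poch (z + m) n‖ ≤ K ^ n * 2 ^ (m + n) * n.factorial := by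
  refine ⟨‖z‖ + 1, by positivity, fun m n => ?_⟩
  have h (n : ℕ) : ‖poch (z + m) n‖ * m.factorial ≤ (‖z‖ + 1) ^ n * (m + n).factorial := by
    induction n with
    | zero => simp [poch_zero]
    | succ n ih =>
      have h1 : ‖z + m + n‖ ≤ (‖z‖ + 1) * (m + n + 1) := by
        have h2 : ‖z + m + n‖ ≤ ‖z‖ + m + n := by
          refine (norm_add_le _ _).trans (add_le_add ((norm_add_le _ _).trans ?_) ?_) <;> simp
        have h3 : (0 : ℝ) ≤ ‖z‖ * (m + n) := by positivity
        nlinarith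
      rw [poch_succ, norm_mul, ← add_assoc, Nat.factorial_succ, pow_succ]
      push_cast
      calc ‖poch (z + m) n‖ * ‖z + m + n‖ * m.factorial
          = ‖poch (z + m) n‖ * m.factorial * ‖z + m + n‖ := by ring
        _ ≤ (‖z‖ + 1) ^ n * (m + n).factorial * ((‖z‖ + 1) * (m + n + 1)) := by gcongr
        _ = _ := by ring
  have hm : (0 : ℝ) < m.factorial := by exact_mod_cast m.factorial_pos
  have hc : ((m + n).factorial : ℝ) ≤ 2 ^ (m + n) * (m.factorial * n.factorial) := by
    have h1 : (m + n).choose n ≤ 2 ^ (m + n) := Nat.choose_le_two_pow _ _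
    rw [← Nat.add_choose_mul_factorial_mul_factorial m n]
    push_cast
    rw [mul_assoc]
    gcongr
    exact_mod_cast h1
  refine le_of_mul_le_mul_right ((h n).trans ?_) hm
  calc (‖z‖ + 1) ^ n * ((m + n).factorial : ℝ)
      ≤ (‖z‖ + 1) ^ n * (2 ^ (m + n) * (m.factorial * n.factorial)) := by gcongr
    _ = _ := by ring

theorem factorial_le_norm_poch_add {z : ℂ} (hz : ∀ n : ℕ, z ≠ -(n : ℂ)) :
    ∃ K : ℝ, 0 ≤ K ∧ ∀ m n : ℕ, (n.factorial : ℝ) ≤ K ^ n * ‖poch (z + m) n‖ := by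
  have hpos (n : ℕ) : 0 < ‖z + n‖ :=
    norm_pos_iff.2 fun h => hz n (eq_neg_of_add_eq_zero_left h)
  obtain ⟨n₀, hn₀⟩ := exists_nat_ge (2 * ‖z‖ + 1)
  set K : ℝ := 2 + ∑ n ∈ Finset.range n₀, ((n : ℝ) + 1) / ‖z + n‖ with hK
  have hsum : 0 ≤ ∑ n ∈ Finset.range n₀, ((n : ℝ) + 1) / ‖z + n‖ :=
    Finset.sum_nonneg fun n _ => by positivity
  have hK0 : 0 ≤ K := by linarith
  have hfac (n : ℕ) : (n : ℝ) + 1 ≤ K * ‖z + n‖ := by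
    rcases lt_or_ge n n₀ with h | h
    · rw [← div_le_iff₀ (hpos n)]
      have := Finset.single_le_sum (f := fun n : ℕ => ((n : ℝ) + 1) / ‖z + n‖)
        (fun n _ => by positivity) (Finset.mem_range.2 h)
      linarith
    · have h1 : (n₀ : ℝ) ≤ n := by exact_mod_cast h
      have h2 : (n : ℝ) ≤ ‖z + n‖ + ‖z‖ := by
        have := norm_sub_le (z + n) z
        simpa using this
      have h3 : 2 * ‖z + n‖ ≤ K * ‖z + n‖ := by
        gcongr
        linarith
      linarith
  refine ⟨K, hK0, fun m n => ?_⟩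
  induction n with
  | zero => simp [poch_zero]
  | succ n ih =>
    have h1 : (n : ℝ) + 1 ≤ K * ‖z + m + n‖ := by
      have := hfac (m + n)
      push_cast at this
      rw [← add_assoc] at this
      have : (0 : ℝ) ≤ m := m.cast_nonneg
      linarith
    rw [poch_succ, norm_mul, Nat.factorial_succ, pow_succ]
    push_cast
    calc ((n : ℝ) + 1) * n.factorial
        ≤ (K * ‖z + m + n‖) * (K ^ n * ‖poch (z + m) n‖) := by gcongr
      _ = _ := by ring

theorem inv_norm_poch_add_le {z : ℂ} (hz : ∀ n : ℕ, z ≠ -(n : ℂ)) :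
    ∃ K : ℝ, 0 ≤ K ∧ ∀ m n : ℕ, ‖poch (z + m) n‖⁻¹ ≤ K ^ n / n.factorial := by
  obtain ⟨K, hK, h⟩ := factorial_le_norm_poch_add hz
  refine ⟨K, hK, fun m n => ?_⟩
  have h1 : 0 < ‖poch (z + m) n‖ := norm_pos_iff.2 (poch_ne_zero (add_natCast_ne_neg hz m) n)
  have h2 : (0 : ℝ) < n.factorial := by exact_mod_cast n.factorial_pos
  rw [inv_le_iff_one_le_mul₀ h1, div_mul_eq_mul_div, one_le_div h2]
  exact h m n

theorem norm_zeroFOne_term_le {p : ℂ} (hp : ∀ n : ℕ, p ≠ -(n : ℂ)) :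
    ∃ K : ℝ, 0 ≤ K ∧ ∀ (u : ℂ) (n : ℕ),
      ‖u ^ n / (poch p n * n.factorial)‖ ≤ (K * ‖u‖) ^ n / n.factorial := by
  obtain ⟨K, hK, h⟩ := inv_norm_poch_add_le hp
  refine ⟨K, hK, fun u n => ?_⟩
  have h1 := h 0 n
  have h2 : (1 : ℝ) ≤ n.factorial := by exact_mod_cast n.factorial_pos
  rw [Nat.cast_zero, add_zero] at h1
  have h3 : ‖poch p n‖⁻¹ ≤ K ^ n := h1.trans (div_le_self (by positivity) h2)
  rw [norm_div, norm_mul, norm_pow, Complex.norm_natCast, mul_pow,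
    show ‖u‖ ^ n / (‖poch p n‖ * n.factorial) = ‖poch p n‖⁻¹ * ‖u‖ ^ n / n.factorial by
      rw [div_mul_eq_div_div]; ring]
  gcongr

theorem norm_prodCoeff_le {p q : ℂ} (hp : ∀ n : ℕ, p ≠ -(n : ℂ)) (hq : ∀ n : ℕ, q ≠ -(n : ℂ))
    (u v : ℂ) : ∃ C : ℝ, 0 ≤ C ∧ ∀ N : ℕ, ‖prodCoeff p q u v N‖ ≤ C ^ N / N.factorial := by
  obtain ⟨K, hK, h⟩ := norm_zeroFOne_term_le hp
  obtain ⟨L, hL, h'⟩ := norm_zeroFOne_term_le hq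
  refine ⟨K * ‖-u‖ + L * ‖v‖, by positivity, fun N => ?_⟩
  rw [(Commute.all (K * ‖-u‖) (L * ‖v‖)).add_pow', Finset.sum_div]
  refine (norm_sum_le _ _).trans (Finset.sum_le_sum fun a ha => ?_)
  rw [norm_mul, nsmul_eq_mul, ← Finset.HasAntidiagonal.mem_antidiagonal.1 ha, Nat.cast_add_choose]
  refine (mul_le_mul (h _ _) (h' _ _) (norm_nonneg _) (by positivity)).trans_eq ?_
  have f1 := Nat.cast_ne_zero (R := ℝ).2 a.1.factorial_ne_zero
  have f2 := Nat.cast_ne_zero (R := ℝ).2 a.2.factorial_ne_zero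
  have f3 := Nat.cast_ne_zero (R := ℝ).2 (a.1 + a.2).factorial_ne_zero
  field_simp

theorem pFq_zeroFOne (p z : ℂ) : pFq [] [p] z = ∑' n : ℕ, z ^ n / (poch p n * n.factorial) := by
  unfold pFq
  refine tsum_congr fun n => ?_
  simp [div_eq_mul_inv]
  ring

theorem summable_norm_zeroFOne {p : ℂ} (hp : ∀ n : ℕ, p ≠ -(n : ℂ)) (z : ℂ) :
    Summable fun n : ℕ => ‖z ^ n / (poch p n * n.factorial)‖ := by
  obtain ⟨K, -, h⟩ := norm_zeroFOne_term_le hp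
  exact (Real.summable_pow_div_factorial (K * ‖z‖)).of_nonneg_of_le (fun n => norm_nonneg _) (h z)

theorem continuous_zeroFOne {p : ℂ} (hp : ∀ n : ℕ, p ≠ -(n : ℂ)) : Continuous (pFq [] [p]) := by
  obtain ⟨K, hK, h⟩ := norm_zeroFOne_term_le hp
  rw [show pFq [] [p] = fun z => ∑' n : ℕ, z ^ n / (poch p n * n.factorial) from
    funext (pFq_zeroFOne p), continuous_iff_continuousAt]
  intro z
  have hc : ContinuousOn (fun z : ℂ => ∑' n : ℕ, z ^ n / (poch p n * n.factorial))
      (Metric.closedBall 0 (‖z‖ + 1)) := by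
    refine continuousOn_tsum (fun n => by fun_prop)
      (Real.summable_pow_div_factorial (K * (‖z‖ + 1))) fun n w hw => (h w n).trans ?_
    have : ‖w‖ ≤ ‖z‖ + 1 := by simpa using hw
    gcongr
  refine hc.continuousAt (Metric.closedBall_mem_nhds_of_mem ?_)
  simp

theorem zeroFOne_mul_zeroFOne {p q : ℂ} (hp : ∀ n : ℕ, p ≠ -(n : ℂ)) (hq : ∀ n : ℕ, q ≠ -(n : ℂ))
    (u v ρ : ℂ) : pFq [] [p] (-(u * ρ)) * pFq [] [q] (v * ρ) =
      ∑' N : ℕ, prodCoeff p q u v N * ρ ^ N := by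
  rw [pFq_zeroFOne, pFq_zeroFOne, tsum_mul_tsum_eq_tsum_sum_antidiagonal_of_summable_norm
    (summable_norm_zeroFOne hp _) (summable_norm_zeroFOne hq _)]
  refine tsum_congr fun N => ?_
  rw [prodCoeff, Finset.sum_mul]
  refine Finset.sum_congr rfl fun a ha => ?_
  rw [← Finset.HasAntidiagonal.mem_antidiagonal.1 ha, ← neg_mul, mul_pow, mul_pow, pow_add]
  ring

/-- The coefficient of `ρ ^ (k + j)` in the `k`-th term of the expansion in Jacobi polynomials,
with `p`, `q`, `r` standing for `α + 1`, `β + 1`, `γ + 1`. -/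
noncomputable def expansionCoeff (p q r u v : ℂ) (a : ℕ × ℕ) : ℂ :=
  poch (p + q - 1 + (a.1 + a.2 : ℕ)) a.1 * poch (p - r) a.2 /
    (poch (r + q - 1 + a.1) a.1 * poch (r + q + (2 * a.1 : ℕ)) a.2 * a.2.factorial) *
    (poch r a.1 * prodCoeff r q u v a.1) / poch p (a.1 + a.2)

theorem prodCoeff_eq_sum_expansionCoeff {p q r : ℂ} (hp : ∀ n : ℕ, p ≠ -(n : ℂ))
    (hq : ∀ n : ℕ, q ≠ -(n : ℂ)) (hr : ∀ n : ℕ, r ≠ -(n : ℂ))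
    (hs : ∀ n : ℕ, r + q - 1 ≠ -(n : ℂ)) (v : ℂ) (N : ℕ) :
    prodCoeff p q (1 - v) v N =
      ∑ a ∈ Finset.HasAntidiagonal.antidiagonal N, expansionCoeff p q r (1 - v) v a := by
  have h := prodCoeff_connection hp hq hr hs v N
  rw [mul_comm, ← eq_div_iff (poch_ne_zero hp N), Finset.sum_div] at h
  rw [h]
  refine Finset.sum_congr rfl fun a ha => ?_
  rw [expansionCoeff, Finset.HasAntidiagonal.mem_antidiagonal.1 ha]
  rw [show (N : ℂ) + p + q - 1 = p + q - 1 + N by ring,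
    show (a.1 : ℂ) + r + q - 1 = r + q - 1 + a.1 by ring,
    show 2 * (a.1 : ℂ) + r + q = r + q + (2 * a.1 : ℕ) by push_cast; ring]

theorem norm_expansionCoeff_le {p q r : ℂ} (hp : ∀ n : ℕ, p ≠ -(n : ℂ))
    (hq : ∀ n : ℕ, q ≠ -(n : ℂ)) (hr : ∀ n : ℕ, r ≠ -(n : ℂ))
    (hs : ∀ n : ℕ, r + q - 1 ≠ -(n : ℂ)) (u v : ℂ) :
    ∃ A B : ℝ, ∀ a : ℕ × ℕ, ‖expansionCoeff p q r u v a‖ ≤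
      A ^ a.1 / a.1.factorial * (B ^ a.2 / a.2.factorial) := by
  have hs' : ∀ n : ℕ, r + q ≠ -(n : ℂ) := by
    simpa using add_natCast_ne_neg hs 1
  obtain ⟨K₁, hK₁, h₁⟩ := norm_poch_add_le (p + q - 1)
  obtain ⟨K₂, hK₂, h₂⟩ := norm_poch_add_le (p - r)
  obtain ⟨K₃, hK₃, h₃⟩ := inv_norm_poch_add_le hs
  obtain ⟨K₄, hK₄, h₄⟩ := inv_norm_poch_add_le hs'
  obtain ⟨K₅, hK₅, h₅⟩ := norm_poch_add_le r
  obtain ⟨K₆, hK₆, h₆⟩ := inv_norm_poch_add_le hp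
  obtain ⟨C, hC, h₇⟩ := norm_prodCoeff_le hr hq u v
  refine ⟨K₁ * 4 * K₃ * K₅ * 2 * C * K₆, K₂ * 4 * K₄ * K₆, fun a => ?_⟩
  obtain ⟨k, j⟩ := a
  have g₂ := h₂ 0 j
  have g₅ := h₅ 0 k
  have g₆ := h₆ 0 (k + j)
  simp only [Nat.cast_zero, add_zero, zero_add] at g₂ g₅ g₆
  have fk : (1 : ℝ) ≤ k.factorial := by exact_mod_cast k.factorial_pos
  have fj : (1 : ℝ) ≤ j.factorial := by exact_mod_cast j.factorial_pos
  have fkj : (k.factorial : ℝ) ≤ (k + j).factorial := by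
    exact_mod_cast Nat.factorial_le (Nat.le_add_right k j)
  have e : ‖expansionCoeff p q r u v (k, j)‖ =
      ‖poch (p + q - 1 + (k + j : ℕ)) k‖ * ‖poch (p - r) j‖ * ‖poch (r + q - 1 + k) k‖⁻¹ *
      ‖poch (r + q + (2 * k : ℕ)) j‖⁻¹ * ((j.factorial : ℝ))⁻¹ * ‖poch r k‖ *
      ‖prodCoeff r q u v k‖ * ‖poch p (k + j)‖⁻¹ := by
    simp only [expansionCoeff, norm_div, norm_mul, Complex.norm_natCast]
    simp only [div_eq_mul_inv, mul_inv]
    ring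
  rw [e]
  calc _ ≤ (K₁ ^ k * 2 ^ (k + j + k) * k.factorial) * (K₂ ^ j * 2 ^ j * j.factorial) *
        (K₃ ^ k / k.factorial) * (K₄ ^ j / j.factorial) * ((j.factorial : ℝ))⁻¹ *
        (K₅ ^ k * 2 ^ k * k.factorial) * (C ^ k / k.factorial) *
        (K₆ ^ (k + j) / (k + j).factorial) := by
        gcongr
        · exact h₁ _ _
        · exact h₃ _ _
        · exact h₄ _ _
        · exact h₇ _
    _ = (K₁ * 4 * K₃ * K₅ * 2 * C * K₆) ^ k * (K₂ * 4 * K₄ * K₆) ^ j / j.factorial /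
        (k + j).factorial := by
        have f1 : (k.factorial : ℝ) ≠ 0 := by positivity
        have f2 : (j.factorial : ℝ) ≠ 0 := by positivity
        have f3 : ((k + j).factorial : ℝ) ≠ 0 := by positivity
        rw [show (4 : ℝ) = 2 * 2 by norm_num]
        generalize (2 : ℝ) = t
        field_simp
        ring
    _ ≤ (K₁ * 4 * K₃ * K₅ * 2 * C * K₆) ^ k * (K₂ * 4 * K₄ * K₆) ^ j / j.factorial /
        k.factorial := by gcongr
    _ = _ := by ring

theorem summable_expansionCoeff {p q r : ℂ} (hp : ∀ n : ℕ, p ≠ -(n : ℂ))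
    (hq : ∀ n : ℕ, q ≠ -(n : ℂ)) (hr : ∀ n : ℕ, r ≠ -(n : ℂ))
    (hs : ∀ n : ℕ, r + q - 1 ≠ -(n : ℂ)) (u v ρ : ℂ) :
    Summable fun a : ℕ × ℕ => expansionCoeff p q r u v a * ρ ^ (a.1 + a.2) := by
  obtain ⟨A, B, h⟩ := norm_expansionCoeff_le hp hq hr hs u v
  have hs := summable_mul_of_summable_norm
    (Real.summable_pow_div_factorial (A * ‖ρ‖)).norm (Real.summable_pow_div_factorial (B * ‖ρ‖)).norm
  refine hs.of_norm_bounded fun a => ?_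
  rw [norm_mul, norm_pow]
  refine (mul_le_mul_of_nonneg_right (h a) (by positivity)).trans_eq ?_
  rw [mul_pow, mul_pow, pow_add]
  ring

theorem tsum_prodCoeff_eq {p q r : ℂ} (hp : ∀ n : ℕ, p ≠ -(n : ℂ))
    (hq : ∀ n : ℕ, q ≠ -(n : ℂ)) (hr : ∀ n : ℕ, r ≠ -(n : ℂ))
    (hs : ∀ n : ℕ, r + q - 1 ≠ -(n : ℂ)) (v ρ : ℂ) :
    ∑' N : ℕ, prodCoeff p q (1 - v) v N * ρ ^ N =
      ∑' k : ℕ, ∑' j : ℕ, expansionCoeff p q r (1 - v) v (k, j) * ρ ^ (k + j) := by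
  have h := summable_expansionCoeff hp hq hr hs (1 - v) v ρ
  have h' := (Finset.HasAntidiagonal.sigmaAntidiagonalEquivProd (A := ℕ)).summable_iff.2 h
  rw [← h.tsum_prod, ← Finset.HasAntidiagonal.sigmaAntidiagonalEquivProd.tsum_eq]
  refine Eq.trans ?_ (h'.tsum_sigma' fun n => (hasSum_fintype _).summable).symm
  refine tsum_congr fun N => ?_
  rw [prodCoeff_eq_sum_expansionCoeff hp hq hr hs, Finset.sum_mul, ← Finset.sum_finset_coe,
    tsum_fintype]
  refine Finset.sum_congr rfl fun a _ => ?_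
  have := Finset.HasAntidiagonal.mem_antidiagonal.1 a.2
  simp [this]

theorem expansionTerm_prefactor {α β γ : ℂ} (hγβ : ∀ n : ℕ, γ + β + 1 ≠ -(n : ℂ)) (k : ℕ) :
    (2 * (k : ℂ) + γ + β + 1) * poch (γ + β + 1) k
      * poch ((α + β + 1) / 2) k * poch ((α + β + 2) / 2) k
    / (poch (α + 1) k * poch (β + 1) k * poch (α + β + 1) k
      * poch ((γ + β + 2) / 2) k * poch ((γ + β + 3) / 2) k) =
    (γ + β + 1) * poch (α + β + 1) (2 * k) /
      (poch (α + 1) k * poch (β + 1) k * poch (α + β + 1) k * poch (γ + β + 1 + k) k) := by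
  have hγβ' : ∀ n : ℕ, γ + β + 2 ≠ -(n : ℂ) := by
    intro n h
    refine add_natCast_ne_neg hγβ 1 n ?_
    push_cast
    linear_combination h
  have e1 := poch_two_mul (α + β + 1) k
  have e2 := poch_two_mul (γ + β + 2) k
  rw [show γ + β + 2 + 1 = γ + β + 3 by ring] at e2
  rw [show α + β + 1 + 1 = α + β + 2 by ring] at e1
  have e3 : (2 * (k : ℂ) + γ + β + 1) * poch (γ + β + 1) k * poch (γ + β + 1 + k) k =
      (γ + β + 1) * poch (γ + β + 2) (2 * k) := by
    have e5 := poch_succ (γ + β + 1) (2 * k)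
    rw [poch_succ_left, show γ + β + 1 + 1 = γ + β + 2 by ring] at e5
    rw [e5, two_mul k, poch_add]
    push_cast
    ring
  have n4 := poch_ne_zero hγβ' (2 * k)
  have n5 := poch_ne_zero (add_natCast_ne_neg hγβ k) k
  rw [e2] at n4 e3
  have n6 := right_ne_zero_of_mul n4
  have n7 := right_ne_zero_of_mul (left_ne_zero_of_mul n4)
  rw [e1, ← mul_div_mul_right _ _ n5, show (2 * (k : ℂ) + γ + β + 1) * poch (γ + β + 1) k
      * poch ((α + β + 1) / 2) k * poch ((α + β + 2) / 2) k * poch (γ + β + 1 + k) k =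
      (2 * (k : ℂ) + γ + β + 1) * poch (γ + β + 1) k * poch (γ + β + 1 + k) k
      * poch ((α + β + 1) / 2) k * poch ((α + β + 2) / 2) k by ring, e3]
  refine Eq.trans ?_ (mul_div_mul_right _ _ (mul_ne_zero n7 n6))
  congr 1 <;> ring

theorem expansionTerm_eq {α β γ : ℂ} (hα : ∀ n : ℕ, α + 1 ≠ -(n : ℂ))
    (hβ : ∀ n : ℕ, β + 1 ≠ -(n : ℂ)) (hγ : ∀ n : ℕ, γ + 1 ≠ -(n : ℂ))
    (hαβ : ∀ n : ℕ, α + β + 1 ≠ -(n : ℂ)) (hγβ : ∀ n : ℕ, γ + β + 1 ≠ -(n : ℂ)) (x ρ : ℂ) (k : ℕ) :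
    expansionTerm α β γ x ρ k = (γ + β + 1) * ∑' j : ℕ,
      expansionCoeff (α + 1) (β + 1) (γ + 1) ((1 - x) / 2) ((1 + x) / 2) (k, j) * ρ ^ (k + j) := by
  have hJ := jacobiP_eq_prodCoeff hγ hβ x k
  rw [add_sub_cancel_right, add_sub_cancel_right] at hJ
  rw [expansionTerm, hJ, pFq, expansionTerm_prefactor hγβ]
  simp only [← tsum_mul_left, ← tsum_mul_right]
  refine tsum_congr fun j => ?_
  have e3 : poch (α + β + 1) (2 * k) * poch (α + β + 1 + (2 * k : ℕ)) j =
      poch (α + β + 1) k * poch (α + β + 1 + k) j * poch (α + β + 1 + (k + j : ℕ)) k := by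
    rw [← poch_add, ← poch_add, ← poch_add]
    congr 1
    ring
  have n1 := poch_ne_zero hα k
  have n2 := poch_ne_zero hβ k
  have n3 := poch_ne_zero hαβ k
  have n4 := poch_ne_zero (add_natCast_ne_neg hαβ k) j
  have hA : poch (α + β + 1 + (k + j : ℕ)) k = poch (α + β + 1) (2 * k) *
      poch (α + β + 1 + (2 * k : ℕ)) j / (poch (α + β + 1) k * poch (α + β + 1 + k) j) := by
    rw [eq_div_iff (mul_ne_zero n3 n4), e3, mul_comm]
  simp only [List.map_cons, List.map_nil, List.prod_cons, List.prod_nil, mul_one, expansionCoeff]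
  rw [show α + 1 + (β + 1) - 1 + (k + j : ℕ) = α + β + 1 + (k + j : ℕ) by ring, hA, poch_add _ k j,
    show 2 * (k : ℂ) + α + β + 1 = α + β + 1 + (2 * k : ℕ) by push_cast; ring,
    show α + β + (k : ℂ) + 1 = α + β + 1 + k by ring,
    show γ + β + 2 * (k : ℂ) + 2 = γ + 1 + (β + 1) + (2 * k : ℕ) by push_cast; ring,
    show α + (k : ℂ) + 1 = α + 1 + k by ring,
    show α + 1 - (γ + 1) = α - γ by ring,
    show γ + 1 + (β + 1) - 1 + (k : ℂ) = γ + β + 1 + k by ring, pow_add]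
  clear hA e3 hJ
  generalize poch (α + 1) k = P at *
  generalize poch (β + 1) k = Q at *
  generalize poch (α + β + 1) k = A at *
  generalize poch (α + β + 1 + k) j = A' at *
  generalize poch (α + β + 1) (2 * k) = A₂
  generalize poch (α + β + 1 + (2 * k : ℕ)) j = A₃
  generalize poch (γ + β + 1 + k) k = S
  generalize poch (γ + 1 + (β + 1) + (2 * k : ℕ)) j = S'
  generalize poch (α + 1 + k) j = P'
  generalize poch (α - γ) j = F
  generalize prodCoeff (γ + 1) (β + 1) ((1 - x) / 2) ((1 + x) / 2) k = E
  generalize poch (γ + 1) k = R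
  generalize γ + β + 1 = s
  generalize ρ ^ k = y
  generalize ρ ^ j = z
  calc _ = s * A₂ * A₃ * F * R * E * y * z * (Q * Q⁻¹) * P⁻¹ * A⁻¹ * S⁻¹ * A'⁻¹ * S'⁻¹ * P'⁻¹ *
        (j.factorial : ℂ)⁻¹ := by simp only [div_eq_mul_inv, mul_inv]; ring
    _ = _ := by
      rw [mul_inv_cancel₀ n2]
      simp only [div_eq_mul_inv, mul_inv]
      ring

theorem one_div_cpow_mul_sqrt_cpow {w : ℂ} (hw : w ∈ Complex.slitPlane) (ν : ℂ) :
    (1 / w) ^ (ν / 2) * (w ^ (1 / 2 : ℂ)) ^ ν = 1 := by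
  have h0 := Complex.slitPlane_ne_zero hw
  have harg : w.arg ≠ Real.pi := (Complex.mem_slitPlane_iff_arg.1 hw).1
  have hlog : Complex.log (w ^ (1 / 2 : ℂ)) = Complex.log w * (1 / 2) := by
    rw [Complex.cpow_def_of_ne_zero h0, Complex.log_exp]
    all_goals
      have h1 := Complex.neg_pi_lt_arg w
      have h2 := Complex.arg_le_pi w
      have h3 : (Complex.log w * (1 / 2)).im = w.arg / 2 := by
        rw [show (1 / 2 : ℂ) = ((1 / 2 : ℝ) : ℂ) by push_cast; ring, Complex.im_mul_ofReal,
          Complex.log_im]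
        ring
      rw [h3]
      linarith [Real.pi_pos]
  have h1 : w ^ (1 / 2 : ℂ) ≠ 0 := by simp [Complex.cpow_eq_zero_iff, h0]
  rw [Complex.cpow_def_of_ne_zero h1, hlog, one_div, Complex.inv_cpow _ _ harg,
    Complex.cpow_def_of_ne_zero h0, ← Complex.exp_neg, ← Complex.exp_add]
  rw [show -(Complex.log w * (ν / 2)) + Complex.log w * (1 / 2) * ν = 0 by ring, Complex.exp_zero]

theorem ofReal_mul_mem_slitPlane {t : ℝ} (ht : 0 < t) {ρ : ℂ} (hρ : ρ ∈ Complex.slitPlane) :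
    (t : ℂ) * ρ ∈ Complex.slitPlane := by
  rw [Complex.mem_slitPlane_iff_arg] at hρ ⊢
  rw [Complex.arg_real_mul _ ht]
  exact ⟨hρ.1, mul_ne_zero (by exact_mod_cast ht.ne') hρ.2⟩

theorem sqrt_four_mul_div_two {w : ℂ} (hw : w ≠ 0) :
    (4 * w) ^ (1 / 2 : ℂ) / 2 = w ^ (1 / 2 : ℂ) := by
  have h4 : Complex.log (4 * w) = (Real.log 4 : ℝ) + Complex.log w := by
    rw [← Complex.log_ofReal_mul (by norm_num) hw]
    norm_num
  have h2 : Real.log 4 = 2 * Real.log 2 := by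
    rw [show (4 : ℝ) = 2 ^ 2 by norm_num, Real.log_pow]
    norm_num
  rw [Complex.cpow_def_of_ne_zero (mul_ne_zero (by norm_num) hw), h4, h2,
    show (((2 * Real.log 2 : ℝ) : ℂ) + Complex.log w) * (1 / 2) =
      (Real.log 2 : ℝ) + Complex.log w * (1 / 2) by push_cast; ring,
    Complex.exp_add, ← Complex.ofReal_exp, Real.exp_log (by norm_num),
    Complex.cpow_def_of_ne_zero hw]
  push_cast
  ring

theorem sq_sqrt_four_mul (w : ℂ) : ((4 * w) ^ (1 / 2 : ℂ)) ^ 2 = 4 * w := by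
  simp

theorem besselProduct_eq {α β x : ℂ} {u v : ℝ} (hu : 0 < u) (hv : 0 < v) (hxu : 1 - x = 2 * u)
    (hxv : 1 + x = 2 * v) {ρ : ℂ} (hρ : ρ ∈ Complex.slitPlane) :
    besselProduct α β x ρ = 1 / (Complex.Gamma (α + 1) * Complex.Gamma (β + 1)) *
      (pFq [] [α + 1] (-(u * ρ)) * pFq [] [β + 1] (v * ρ)) := by
  have hu' := ofReal_mul_mem_slitPlane hu hρ
  have hv' := ofReal_mul_mem_slitPlane hv hρ
  have hJ := one_div_cpow_mul_sqrt_cpow hu' α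
  have hI := one_div_cpow_mul_sqrt_cpow hv' β
  have e (t : ℂ) : 2 / (2 * t * ρ) = 1 / (t * ρ) := by
    rw [mul_assoc, ← mul_div_mul_left 1 (t * ρ) two_ne_zero, mul_one]
  have e' (t : ℂ) : 2 * (2 * t) * ρ = 4 * (t * ρ) := by ring
  rw [besselProduct, besselJ, besselI, hxu, hxv, e, e, e', e', sq_sqrt_four_mul, sq_sqrt_four_mul,
    sqrt_four_mul_div_two (Complex.slitPlane_ne_zero hu'),
    sqrt_four_mul_div_two (Complex.slitPlane_ne_zero hv'),
    show -(4 * ((u : ℂ) * ρ)) / 4 = -(u * ρ) by ring, show 4 * ((v : ℂ) * ρ) / 4 = v * ρ by ring]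
  calc _ = ((1 / (u * ρ)) ^ (α / 2) * ((u * ρ) ^ (1 / 2 : ℂ)) ^ α) *
        ((1 / (v * ρ)) ^ (β / 2) * ((v * ρ) ^ (1 / 2 : ℂ)) ^ β) *
        ((Complex.Gamma (α + 1))⁻¹ * (Complex.Gamma (β + 1))⁻¹ *
        (pFq [] [α + 1] (-(u * ρ)) * pFq [] [β + 1] (v * ρ))) := by
        simp only [div_eq_mul_inv]; ring
    _ = _ := by rw [hJ, hI, one_mul, one_mul, one_div, mul_inv]

theorem mainTheorem2 (α : ℂ) (β γ : ℝ) (hβ : -1 < β) (hγ : -1 < γ)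
    (hβγ : β ∈ Set.Ioo (-1 : ℝ) 0 → γ ∈ Set.Ioo (-1 : ℝ) 0 → β + γ + 1 ≠ 0)
    (hα : ∀ n : ℕ, α + 1 ≠ -(n : ℂ)) (hαβ : ∀ n : ℕ, α + β + 1 ≠ -(n : ℂ))
    (ρ : ℂ) (hρ : ‖ρ‖ < 1) (x : ℝ) (hx : x ∈ Set.Ioo (-1 : ℝ) 1) :
    Summable (expansionTerm α β γ x ρ) ∧
    (ρ ∈ Complex.slitPlane →
      besselProduct α β x ρ =
        1 / (((γ : ℂ) + β + 1) * Complex.Gamma (α + 1) * Complex.Gamma ((β : ℂ) + 1))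
          * ∑' k : ℕ, expansionTerm α β γ x ρ k) ∧
    (ρ ∉ Complex.slitPlane →
      Tendsto (fun r : ℂ => besselProduct α β x r) (𝓝[Complex.slitPlane] ρ)
        (𝓝 (1 / (((γ : ℂ) + β + 1) * Complex.Gamma (α + 1) * Complex.Gamma ((β : ℂ) + 1))
          * ∑' k : ℕ, expansionTerm α β γ x ρ k))) := by
  have hβ' : ∀ n : ℕ, (β : ℂ) + 1 ≠ -(n : ℂ) := by
    exact_mod_cast ofReal_ne_neg_natCast (t := β + 1) (by linarith)
  have hγ' : ∀ n : ℕ, (γ : ℂ) + 1 ≠ -(n : ℂ) := by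
    exact_mod_cast ofReal_ne_neg_natCast (t := γ + 1) (by linarith)
  have hs0 : γ + β + 1 ≠ 0 := by
    intro h
    exact hβγ ⟨hβ, by linarith⟩ ⟨hγ, by linarith⟩ (by linarith)
  have hs : ∀ n : ℕ, (γ : ℂ) + β + 1 ≠ -(n : ℂ) := by
    intro n h
    have h' : γ + β + 1 = -(n : ℝ) := by exact_mod_cast h
    rcases n.eq_zero_or_pos with rfl | hn
    · exact hs0 (by simpa using h')
    · have : (1 : ℝ) ≤ n := by exact_mod_cast hn
      linarith
  have hs0' : (γ : ℂ) + β + 1 ≠ 0 := by exact_mod_cast hs0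
  have hs' : ∀ n : ℕ, (γ : ℂ) + 1 + (β + 1) - 1 ≠ -(n : ℂ) := by
    intro n
    rw [show (γ : ℂ) + 1 + (β + 1) - 1 = γ + β + 1 by ring]
    exact hs n
  have hu : 0 < (1 - x) / 2 := by linarith [hx.2]
  have hv : 0 < (1 + x) / 2 := by linarith [hx.1]
  have hterm : expansionTerm α β γ x ρ = fun k => ((γ : ℂ) + β + 1) * ∑' j : ℕ,
      expansionCoeff (α + 1) (β + 1) (γ + 1) ((1 - x) / 2) ((1 + x) / 2) (k, j) * ρ ^ (k + j) :=
    funext (expansionTerm_eq hα hβ' hγ' hαβ hs x ρ)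
  have hprod (r : ℂ) (hr : r ∈ Complex.slitPlane) := besselProduct_eq (α := α) (β := β) (x := x)
    hu hv (by push_cast; ring) (by push_cast; ring) hr
  have hsum : 1 / (((γ : ℂ) + β + 1) * Complex.Gamma (α + 1) * Complex.Gamma ((β : ℂ) + 1))
      * ∑' k : ℕ, expansionTerm α β γ x ρ k =
      1 / (Complex.Gamma (α + 1) * Complex.Gamma (β + 1)) *
      (pFq [] [α + 1] (-(((1 - x) / 2 : ℝ) * ρ)) * pFq [] [(β : ℂ) + 1] (((1 + x) / 2 : ℝ) * ρ)) := by
    have h := tsum_prodCoeff_eq hα hβ' hγ' hs' ((1 + x) / 2) ρ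
    rw [show (1 : ℂ) - (1 + x) / 2 = (1 - x) / 2 by ring] at h
    rw [zeroFOne_mul_zeroFOne hα hβ', hterm, tsum_mul_left]
    push_cast
    rw [h]
    simp only [one_div, mul_inv]
    rw [show ∀ a b c d e : ℂ, a * b * c * (d * e) = a * d * (b * c * e) by intros; ring,
      inv_mul_cancel₀ hs0', one_mul]
  refine ⟨?_, fun hr => ?_, fun _ => ?_⟩
  · rw [hterm]
    exact ((summable_expansionCoeff hα hβ' hγ' hs' _ _ ρ).prod).mul_left _
  · rw [hsum, hprod ρ hr]
  · rw [hsum]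
    have hc : Continuous fun r : ℂ => 1 / (Complex.Gamma (α + 1) * Complex.Gamma (β + 1)) *
        (pFq [] [α + 1] (-(((1 - x) / 2 : ℝ) * r)) *
          pFq [] [(β : ℂ) + 1] (((1 + x) / 2 : ℝ) * r)) := by
      have h1 := continuous_zeroFOne hα
      have h2 := continuous_zeroFOne hβ'
      fun_prop
    refine ((hc.tendsto ρ).mono_left nhdsWithin_le_nhds).congr' ?_
    filter_upwards [self_mem_nhdsWithin] with r hr
    exact (hprod r hr).symm
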